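/- Graphs may have parallel edges but no loops, and paths are finite and do not repeat vertices. Two $a$–$b$ paths are \emph{order-compatible} if their common vertices occur in the same order along both when travelling from $a$ to $b$. For a cardinal $\delta$, \emph{Dirac's question for $\delta$} asks whether the following holds: whenever $a$ and $b$ are two distinct vertices of a graph $G$ such that $G$ contains $\delta$ pairwise edge-disjoint $a$–$b$ paths, then $G$ also contains $\delta$ pairwise edge-disjoint $a$–$b$ paths that are pairwise order-compatible. Corollary 2. Let $\delta$ be an infinite cardinal. Then Dirac's question for $\delta$ has a positive answer if and only if $\delta$ has uncountable cofinality, i.e. $\operatorname{cf}(\delta) > \aleph_0$. -/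

import Mathlib

open scoped Cardinal Graph

universe u

namespace Graph

/-- A (finite) walk from `a` to `b` in the multigraph `G`; it records the edges that it uses, so
that parallel edges are told apart. -/
inductive Walk {V E : Type*} (G : Graph V E) : V → V → Type _
  | nil {a : V} (ha : a ∈ V(G)) : Walk G a a
  | cons {a c b : V} (e : E) (h : G.IsLink e a c) (w : Walk G c b) : Walk G a b

namespace Walk

variable {V E : Type*} {G : Graph V E}

/-- The list of vertices of a walk, in the order in which they are visited from `a` to `b`. -/
def support {a b : V} : G.Walk a b → List V
  | @nil _ _ _ a _ => [a]
  | @cons _ _ _ a _ _ _ _ w => a :: w.support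

/-- The list of edges of a walk, in the order in which they are traversed from `a` to `b`. -/
def edges {a b : V} : G.Walk a b → List E
  | nil _ => []
  | cons e _ w => e :: w.edges

/-- A walk is a path if it does not repeat a vertex. -/
def IsPath {a b : V} (w : G.Walk a b) : Prop :=
  w.support.Nodup

/-- Two walks are edge-disjoint if they have no edge in common. -/
def EdgeDisjoint {a b c d : V} (p : G.Walk a b) (q : G.Walk c d) : Prop :=
  p.edges.Disjoint q.edges

/-- Two `a`–`b` walks (in the applications: paths) are order-compatible if any two common vertices
`x`, `y` occur in the same order along both: `x` is before `y` on `p` exactly when it is on `q`.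
As paths have no repeated vertices, the list `[x, y]` is a sublist of the list of vertices of a path
if and only if the path visits `x` strictly before `y`. -/
def OrderCompatible {a b : V} (p q : G.Walk a b) : Prop :=
  ∀ x y : V, x ∈ p.support → x ∈ q.support → y ∈ p.support → y ∈ q.support →
    (List.Sublist [x, y] p.support ↔ List.Sublist [x, y] q.support)

end Walk

/-- `a ∼_δ b`: the graph `G` contains `δ` pairwise edge-disjoint `a`–`b` paths. -/
def EdgeDisjointlyJoined {V E : Type*} (G : Graph V E) (δ : Cardinal.{u}) (a b : V) : Prop :=
  ∃ (ι : Type u) (P : ι → G.Walk a b), #ι = δ ∧ (∀ i, (P i).IsPath) ∧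
    ∀ i j, i ≠ j → (P i).EdgeDisjoint (P j)

/-- `a ≈_δ b`: the graph `G` contains `δ` pairwise edge-disjoint `a`–`b` paths that are moreover
pairwise order-compatible. -/
def OrderCompatiblyJoined {V E : Type*} (G : Graph V E) (δ : Cardinal.{u}) (a b : V) : Prop :=
  ∃ (ι : Type u) (P : ι → G.Walk a b), #ι = δ ∧ (∀ i, (P i).IsPath) ∧
    (∀ i j, i ≠ j → (P i).EdgeDisjoint (P j)) ∧
    ∀ i j, i ≠ j → (P i).OrderCompatible (P j)

end Graph

/-- Dirac's question for the cardinal `δ` (has a positive answer): in every loopless graph, with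
parallel edges allowed, any two distinct vertices that are joined by `δ` edge-disjoint paths are
joined by `δ` edge-disjoint, pairwise order-compatible paths. -/
def DiracQuestion (δ : Cardinal.{u}) : Prop :=
  ∀ (V E : Type u) (G : Graph V E), G.Loopless → ∀ a ∈ V(G), ∀ b ∈ V(G), a ≠ b →
    G.EdgeDisjointlyJoined δ a b → G.OrderCompatiblyJoined δ a b

/-! If `cf δ > ℵ₀`, edges play no role: any `δ` repetition-free lists include `δ` whose pairwise
common entries form a common sublist (`exists_commonKernel`), which forces order-compatibility. For
regular `δ` this is an ordered `Δ`-system lemma. For singular `δ`, take sunflowers of regular sizes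
unbounded in `δ`, then a sunflower among their `cf δ` kernels, and pick `δ` lists greedily, with
disjoint petals that avoid the kernels.

If `cf δ = ℵ₀`, write `δ = ∑ κ n` with `κ n < δ`. In the zigzag graph, level `n` supplies `κ n`
paths. Among `δ` edge-disjoint paths, fix one; its vertices are multiples of some `3 ^ (-m)`. Some
path avoids the fewer than `δ` edges below level `m`, hence meets those multiples in increasing
order. Compatibility makes the fixed path increasing, but no increasing path leads from `0` to `1`.
-/

/-! ### Cofinality and greedy choice of disjoint sets. -/

/-- The `κ i` are sizes of initial segments along a cofinal set of order type `cf δ`. Unboundedness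
must survive passing to `S`, since the kernels are thinned out later; a full-size `S` is again
cofinal. -/
theorem Cardinal.IsSingular.exists_scale {δ : Cardinal.{u}} (h : δ.IsSingular) :
    ∃ (I : Type u) (κ : I → Cardinal.{u}), #I = δ.ord.cof ∧ (∀ i, κ i < δ) ∧
      ∀ S : Set I, #S = #I → ∀ c < δ, ∃ i ∈ S, c < κ i := by
  obtain ⟨s, hs, hst⟩ := Ordinal.exists_ord_cof_eq δ.ord.ToType
  have hcof : #s = δ.ord.cof := by
    rw [← Ordinal.cof_toType, ← Cardinal.card_ord (Order.cof _), ← hst]; rfl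
  have hδ : ℵ₀ ≤ δ := h.aleph0_le
  refine ⟨s, fun i ↦ #(Set.Iio i.1), hcof, fun i ↦ ?_, fun S hS c hc ↦ ?_⟩
  · simpa using Cardinal.mk_Iio_lt i.1 (by simp)
  · by_contra! hle
    have hScof : IsCofinal S := by
      by_contra hn
      obtain ⟨x, hx⟩ := not_isCofinal_iff.1 hn
      have h1 : #S ≤ #(Set.Iio x) := Cardinal.mk_le_mk_of_subset hx
      have h2 : #(Set.Iio x) < #s := Cardinal.mk_Iio_lt x (by
        rw [hst, hcof, Ordinal.cof_toType])
      exact (h1.trans_lt h2).ne hS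
    have huniv : (Set.univ : Set δ.ord.ToType) ⊆ ⋃ i : S, Set.Iic i.1.1 := by
      intro y _
      obtain ⟨z, hz, hyz⟩ := hs y
      obtain ⟨w, hw, hzw⟩ := hScof ⟨z, hz⟩
      exact Set.mem_iUnion.2 ⟨⟨w, hw⟩, hyz.trans hzw⟩
    have hlt : #(⋃ i : S, Set.Iic i.1.1) < δ := by
      refine (Cardinal.mk_iUnion_le_sum_mk.trans (Cardinal.sum_le_sum _ (fun _ ↦ c + 1)
        fun i ↦ ?_)).trans_lt ?_
      · rw [← Set.Iio_insert]
        exact (Cardinal.mk_insert_le).trans (by gcongr; exact hle _ i.2)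
      · rw [Cardinal.sum_const']
        refine Cardinal.mul_lt_of_lt hδ ?_ (Cardinal.add_lt_of_lt hδ hc
          (Cardinal.one_lt_aleph0.trans_le hδ))
        rw [hS, hcof]
        exact h.cof_ord_lt
    have := (Cardinal.mk_le_mk_of_subset huniv).trans_lt hlt
    simp at this

theorem Cardinal.exists_sum_eq_of_cof_le_aleph0 {δ : Cardinal.{u}} (hδ : ℵ₀ ≤ δ)
    (h : δ.ord.cof ≤ ℵ₀) :
    ∃ κ : ℕ → Cardinal.{u}, (∀ n, κ n < δ) ∧ Cardinal.sum κ = δ := by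
  obtain ⟨s, hs, hsc⟩ := Order.exists_cof_eq δ.ord.ToType
  have hc : s.Countable := by
    rw [← Cardinal.le_aleph0_iff_set_countable, hsc, Ordinal.cof_toType]; exact h
  have hne : s.Nonempty := by
    have : Nonempty δ.ord.ToType := by
      rw [← Cardinal.mk_ne_zero_iff]
      simpa using (Cardinal.aleph0_pos.trans_le hδ).ne'
    exact hs.nonempty
  obtain ⟨f, rfl⟩ := hc.exists_eq_range hne
  have hlt : ∀ n, #(Set.Iic (f n)) < δ := fun n ↦ by
    rw [← Set.Iio_insert]
    exact Cardinal.mk_insert_le.trans_lt <| Cardinal.add_lt_of_lt hδ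
      (by simpa using Cardinal.mk_Iio_lt (f n) (by simp)) (Cardinal.one_lt_aleph0.trans_le hδ)
  refine ⟨fun n ↦ #(Set.Iic (f n)), hlt, le_antisymm ?_ ?_⟩
  · refine (Cardinal.sum_le_sum _ (fun _ ↦ δ) fun n ↦ (hlt n).le).trans ?_
    simp [Cardinal.aleph0_mul_eq hδ]
  · have huniv : (Set.univ : Set δ.ord.ToType) ⊆ ⋃ n, Set.Iic (f n) := by
      intro y _
      obtain ⟨_, ⟨n, rfl⟩, hyz⟩ := hs y
      exact Set.mem_iUnion.2 ⟨n, hyz⟩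
    have := (Cardinal.mk_le_mk_of_subset huniv).trans
      (by simpa using Cardinal.mk_iUnion_le_sum_mk_lift (f := fun n ↦ Set.Iic (f n)))
    simpa using this

/-- If every set of fewer than `δ` points is missed by some member of a family of nonempty finite
sets, then the family has `δ` pairwise disjoint members. -/
theorem exists_pairwiseDisjoint_of_forall_exists_disjoint {X W : Type u} {δ : Cardinal.{u}}
    (hδ : ℵ₀ < δ) (p : X → Set W) (hfin : ∀ x, (p x).Finite) (hne : ∀ x, (p x).Nonempty)
    (H : ∀ A : Set W, #A < δ → ∃ x, Disjoint (p x) A) :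
    ∃ T : Set X, δ ≤ #T ∧ T.PairwiseDisjoint p := by
  obtain ⟨T, hT⟩ := zorn_subset {T : Set X | T.PairwiseDisjoint p} fun c hc hchain ↦
    ⟨⋃₀ c, (Set.pairwiseDisjoint_sUnion hchain.directedOn).2 hc,
      fun s hs ↦ Set.subset_sUnion_of_mem hs⟩
  refine ⟨T, ?_, hT.prop⟩
  by_contra! hlt
  obtain ⟨x, hx⟩ := H (⋃ t : T, p t) <| by
    refine (Cardinal.mk_iUnion_le_sum_mk.trans (Cardinal.sum_le_sum _ (fun _ ↦ ℵ₀)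
      fun t ↦ ?_)).trans_lt ?_
    · exact (Cardinal.lt_aleph0_iff_set_finite.2 (hfin t)).le
    · rw [Cardinal.sum_const']
      exact Cardinal.mul_lt_of_lt hδ.le hlt hδ
  rw [Set.disjoint_iUnion_right] at hx
  -- Maximality puts `x` into `T`, so `p x` is disjoint from itself.
  have hxT : x ∈ T := hT.le_of_ge (y := insert x T)
    (hT.prop.insert fun j hj _ ↦ hx ⟨j, hj⟩) (Set.subset_insert _ _) (Set.mem_insert _ _)
  exact (hne x).ne_empty (disjoint_self.1 (hx ⟨x, hxT⟩))

/-! ### Order of two entries in a list. -/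

namespace List

variable {α : Type*}

theorem Nodup.not_pair_sublist_swap {l : List α} (hl : l.Nodup) {x y : α}
    (h : [x, y] <+ l) : ¬ [y, x] <+ l := by
  induction l with
  | nil => simp at h
  | cons a l ih =>
    intro h'
    rw [nodup_cons] at hl
    rw [cons_sublist_cons'] at h h'
    rcases h with h | ⟨rfl, h⟩ <;> rcases h' with h' | ⟨rfl, h'⟩
    · exact ih hl.2 h h'
    · exact hl.1 (h.subset (by simp))
    · exact hl.1 (h'.subset (by simp))
    · exact hl.1 (h.subset (by simp))

theorem pair_sublist_or_swap {l : List α} {x y : α} (hx : x ∈ l) (hy : y ∈ l) (hxy : x ≠ y) :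
    [x, y] <+ l ∨ [y, x] <+ l := by
  induction l with
  | nil => simp at hx
  | cons a l ih =>
    simp only [cons_sublist_cons', singleton_sublist]
    grind

theorem Sublist.pair_sublist_iff {L l : List α} (h : L <+ l) (hl : l.Nodup) {x y : α}
    (hx : x ∈ L) (hy : y ∈ L) : [x, y] <+ l ↔ [x, y] <+ L := by
  refine ⟨fun hxy ↦ ?_, fun hxy ↦ hxy.trans h⟩
  have hne : x ≠ y := by simpa using hl.sublist hxy
  exact (pair_sublist_or_swap hx hy hne).resolve_right
    fun hyx ↦ hl.not_pair_sublist_swap hxy (hyx.trans h)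

end List

/-! ### Sunflowers of lists and the positive answer. -/

section ListSunflower

variable {ι V : Type u}

/-- The lists indexed by `S` form a sunflower with kernel `L`: they all contain `L` in order, and
no two of them have a further entry in common. -/
structure IsListSunflower (f : ι → List V) (S : Set ι) (L : List V) : Prop where
  sublist : ∀ i ∈ S, L.Sublist (f i)
  mem_kernel : ∀ i ∈ S, ∀ j ∈ S, i ≠ j → ∀ v ∈ f i, v ∈ f j → v ∈ L

/-- The entries of `f i` outside `L`, together with the index `i` itself. -/
def petal (f : ι → List V) (L : List V) (i : ι) : Set (ι ⊕ V) :=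
  insert (Sum.inl i) (Sum.inr '' {v | v ∈ f i ∧ v ∉ L})

theorem finite_petal (f : ι → List V) (L : List V) (i : ι) : (petal f L i).Finite :=
  (((f i).finite_toSet.subset fun _ hv ↦ hv.1).image _).insert _

theorem nonempty_petal (f : ι → List V) (L : List V) (i : ι) : (petal f L i).Nonempty :=
  Set.insert_nonempty _ _

theorem ne_of_disjoint_petal {f : ι → List V} {L L' : List V} {i j : ι}
    (h : Disjoint (petal f L i) (petal f L' j)) : i ≠ j := by
  rintro rfl
  exact Set.disjoint_left.1 h (Set.mem_insert _ _) (Set.mem_insert _ _)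

theorem mem_or_mem_of_disjoint_petal {f : ι → List V} {L L' : List V} {i j : ι}
    (h : Disjoint (petal f L i) (petal f L' j)) {v : V} (hi : v ∈ f i) (hj : v ∈ f j) :
    v ∈ L ∨ v ∈ L' := by
  by_contra! hv
  exact Set.disjoint_left.1 h (Or.inr ⟨v, ⟨hi, hv.1⟩, rfl⟩) (Or.inr ⟨v, ⟨hj, hv.2⟩, rfl⟩)

/-- Each point of `C` spoils fewer than `#B` indices, so by regularity `C` does not spoil all of
`B`. -/
theorem exists_disjoint_petal {f : ι → List V} {B : Set ι} {L : List V} (hB : (#B).IsRegular)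
    (hlt : ∀ v ∉ L, #{i | i ∈ B ∧ v ∈ f i} < #B) {C : Set (ι ⊕ V)} (hC : #C < #B) :
    ∃ i ∈ B, Disjoint (petal f L i) C := by
  by_contra! hno
  have hsub : B ⊆ Sum.inl ⁻¹' C ∪
      ⋃ v : ↥((Sum.inr ⁻¹' C) \ {v | v ∈ L}), {i | i ∈ B ∧ v.1 ∈ f i} := by
    intro i hi
    obtain ⟨w, hw, hwC⟩ := Set.not_disjoint_iff.1 (hno i hi)
    rcases hw with rfl | ⟨v, ⟨hv, hvL⟩, rfl⟩
    · exact Or.inl hwC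
    · exact Or.inr (Set.mem_iUnion.2 ⟨⟨v, hwC, hvL⟩, hi, hv⟩)
  refine (Cardinal.mk_le_mk_of_subset hsub).not_gt ((Cardinal.mk_union_le _ _).trans_lt
    (Cardinal.add_lt_of_lt hB.aleph0_le ?_ ?_))
  · exact (Cardinal.mk_preimage_of_injective _ _ Sum.inl_injective).trans_lt hC
  · refine (Cardinal.card_iUnion_lt_iff_forall_of_isRegular hB ?_).2 fun v ↦ hlt _ v.2.2
    exact (Cardinal.mk_le_mk_of_subset Set.sdiff_subset).trans_lt
      ((Cardinal.mk_preimage_of_injective _ _ Sum.inr_injective).trans_lt hC)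

theorem IsListSunflower.mk_lt {f : ι → List V} {S : Set ι} {L : List V}
    (h : IsListSunflower f S L) (hS : 1 < #S) {v : V} (hv : v ∉ L) :
    #{i | i ∈ S ∧ v ∈ f i} < #S := by
  refine (Cardinal.mk_le_one_iff_set_subsingleton.2 ?_).trans_lt hS
  intro i hi j hj
  by_contra hij
  exact hv (h.mem_kernel i hi.1 j hj.1 hij v hi.2 hj.2)

/-- A family of lists whose size is a regular uncountable cardinal has a
subfamily of the same size all of whose members contain a list `L`, maximal in the sense that no
further entry is common to as many members. -/
theorem exists_common_sublist {f : ι → List V} (hf : ∀ i, (f i).Nodup)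
    (hreg : (#ι).IsRegular) (hω : ℵ₀ < #ι) :
    ∃ (B : Set ι) (L : List V), #B = #ι ∧ (∀ i ∈ B, L.Sublist (f i)) ∧
      ∀ v ∉ L, #{i | i ∈ B ∧ v ∈ f i} < #ι := by
  classical
  have hcof : ℵ₀ < (#ι).ord.cof := by rwa [hreg.cof_ord]
  obtain ⟨⟨n⟩, hn⟩ := Cardinal.infinite_pigeonhole (fun i ↦ ULift.up.{u} (f i).length) hω.le
    (by simpa using hcof)
  set A : Set ι := (fun i ↦ ULift.up.{u} (f i).length) ⁻¹' {⟨n⟩} with hA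
  -- All lists in `A` have length `n`, so a longest sublist common to `#ι` of them exists.
  let P : ℕ → Prop := fun k ↦ ∃ L : List V, L.length = k ∧ #{i | i ∈ A ∧ L.Sublist (f i)} = #ι
  have h0 : P 0 := ⟨[], rfl, by simpa using hn⟩
  obtain ⟨L, hLk, hL⟩ := Nat.findGreatest_spec (P := P) (Nat.zero_le n) h0
  refine ⟨{i | i ∈ A ∧ L.Sublist (f i)}, L, hL, fun i hi ↦ hi.2, fun v hv ↦ ?_⟩
  by_contra! hle
  set D : Set ι := {i | i ∈ {i | i ∈ A ∧ L.Sublist (f i)} ∧ v ∈ f i} with hD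
  -- The position of `v` relative to `L` may vary, but only finitely many arrangements occur; one is
  -- shared by `#ι` lists, against the choice of `L`.
  have hperm : ∀ i : D, (f i).filter (· ∈ v :: L) ∈ (v :: L).permutations := fun i ↦ by
    have hi := i.2.1.2
    rw [List.mem_permutations, List.perm_ext_iff_of_nodup ((hf i).filter _)
      (List.nodup_cons.2 ⟨hv, (hf i).sublist hi⟩)]
    intro a
    have := hi.subset (a := a)
    have := i.2.2
    simp only [List.mem_filter, decide_eq_true_eq]
    grind
  obtain ⟨M, t, ht, htc, htM⟩ := Cardinal.infinite_pigeonhole_set (s := D)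
    (fun i ↦ (⟨_, hperm i⟩ : {l // l ∈ (v :: L).permutations})) (#ι) hle hω.le
    ((Cardinal.lt_aleph0_of_finite _).trans hcof)
  have hMlen : M.1.length = L.length + 1 := by
    simpa using (List.mem_permutations.1 M.2).length_eq
  have hMsub : ∀ i ∈ t, M.1.Sublist (f i) := fun i hi ↦ by
    rw [← htM hi]
    exact List.filter_sublist
  have hP : P (L.length + 1) := by
    refine ⟨M.1, hMlen, le_antisymm (Cardinal.mk_set_le _) (htc.trans ?_)⟩
    exact Cardinal.mk_le_mk_of_subset fun i hi ↦ ⟨(ht hi).1.1, hMsub i hi⟩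
  have hne : t.Nonempty := by
    rw [Set.nonempty_iff_ne_empty]
    rintro rfl
    exact hreg.ne_zero (nonpos_iff_eq_zero.1 (htc.trans (Cardinal.mk_eq_zero _).le))
  obtain ⟨i, hi⟩ := hne
  have hlen : (f i).length = n := by
    have : i ∈ A := (ht hi).1.1
    simpa [hA] using this
  refine Nat.findGreatest_is_greatest (n := n) (k := L.length + 1) (by omega) ?_ hP
  rw [← hMlen, ← hlen]
  exact (hMsub i hi).length_le

/-- An ordered version of the `Δ`-system lemma for finite sets. -/
theorem exists_isListSunflower {f : ι → List V} (hf : ∀ i, (f i).Nodup)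
    (hreg : (#ι).IsRegular) (hω : ℵ₀ < #ι) :
    ∃ (S : Set ι) (L : List V), #S = #ι ∧ IsListSunflower f S L := by
  obtain ⟨B, L, hB, hL, hlt⟩ := exists_common_sublist hf hreg hω
  obtain ⟨T, hT, hdisj⟩ := exists_pairwiseDisjoint_of_forall_exists_disjoint hω
    (fun i : B ↦ petal f L i) (fun _ ↦ finite_petal _ _ _) (fun _ ↦ nonempty_petal _ _ _)
    fun C hC ↦ by
      obtain ⟨i, hi, hd⟩ := exists_disjoint_petal (hB ▸ hreg) (hB ▸ hlt) (hB ▸ hC)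
      exact ⟨⟨i, hi⟩, hd⟩
  refine ⟨Subtype.val '' T, L, le_antisymm (Cardinal.mk_set_le _) ?_, ?_, ?_⟩
  · rwa [Cardinal.mk_image_eq Subtype.val_injective]
  · rintro _ ⟨i, _, rfl⟩
    exact hL i i.2
  · rintro _ ⟨i, hi, rfl⟩ _ ⟨j, hj, rfl⟩ hij v hvi hvj
    exact (mem_or_mem_of_disjoint_petal (hdisj hi hj (ne_of_apply_ne _ hij)) hvi hvj).elim id id

theorem exists_isListSunflower_of_le {f : ι → List V} (hf : ∀ i, (f i).Nodup) {κ : Cardinal.{u}}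
    (hreg : κ.IsRegular) (hω : ℵ₀ < κ) (hκ : κ ≤ #ι) :
    ∃ (S : Set ι) (L : List V), #S = κ ∧ IsListSunflower f S L := by
  obtain ⟨s, rfl⟩ := Cardinal.le_mk_iff_exists_set.1 hκ
  obtain ⟨S, L, hS, hL, hmem⟩ := exists_isListSunflower (f := fun i : s ↦ f i) (fun i ↦ hf i)
    hreg hω
  refine ⟨Subtype.val '' S, L, by rw [Cardinal.mk_image_eq Subtype.val_injective, hS], ?_, ?_⟩
  · rintro _ ⟨i, hi, rfl⟩
    exact hL i hi
  · rintro _ ⟨i, hi, rfl⟩ _ ⟨j, hj, rfl⟩ hij v hvi hvj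
    exact hmem i hi j hj (ne_of_apply_ne _ hij) v hvi hvj

/-- The common entries of the two lists form a common sublist. -/
def CommonKernel (l l' : List V) : Prop :=
  ∃ L : List V, L.Sublist l ∧ L.Sublist l' ∧ ∀ v ∈ l, v ∈ l' → v ∈ L

theorem CommonKernel.pair_sublist_iff {l l' : List V} (h : CommonKernel l l') (hl : l.Nodup)
    (hl' : l'.Nodup) {x y : V} (hx : x ∈ l) (hx' : x ∈ l') (hy : y ∈ l) (hy' : y ∈ l') :
    List.Sublist [x, y] l ↔ List.Sublist [x, y] l' := by
  obtain ⟨L, hL, hL', hmem⟩ := h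
  rw [hL.pair_sublist_iff hl (hmem x hx hx') (hmem y hy hy'),
    hL'.pair_sublist_iff hl' (hmem x hx hx') (hmem y hy hy')]

theorem IsListSunflower.commonKernel {f : ι → List V} {S : Set ι} {L : List V}
    (h : IsListSunflower f S L) {i j : ι} (hi : i ∈ S) (hj : j ∈ S) (hij : i ≠ j) :
    CommonKernel (f i) (f j) :=
  ⟨L, h.sublist i hi, h.sublist j hj, h.mem_kernel i hi j hj hij⟩

theorem exists_commonKernel_of_isSingular {f : ι → List V} (hf : ∀ i, (f i).Nodup)
    (hδ : (#ι).IsSingular) (hω : ℵ₀ < (#ι).ord.cof) :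
    ∃ S : Set ι, #S = #ι ∧ S.Pairwise fun i j ↦ CommonKernel (f i) (f j) := by
  have hωδ : ℵ₀ < #ι := hω.trans_le (Ordinal.cof_ord_le _)
  obtain ⟨I, κ, hI, hκ, hscale⟩ := hδ.exists_scale
  -- The successor makes the block size regular; exceeding `#I` lets a block avoid all kernels at
  -- once, exceeding `κ i` lets it avoid large obstacles.
  have hblock : ∀ i, ∃ (F : Set ι) (K : List V), #F = Order.succ (max #I (κ i)) ∧
      IsListSunflower f F K := fun i ↦ by
    have hle : ℵ₀ ≤ max #I (κ i) := (hI ▸ hω.le).trans (le_max_left _ _)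
    refine exists_isListSunflower_of_le hf (Cardinal.isRegular_succ hle)
      (hle.trans_lt (Order.lt_succ _)) (Order.succ_le_of_lt (max_lt ?_ (hκ i)))
    exact hI ▸ hδ.cof_ord_lt
  choose F K hFc hF using hblock
  have hFreg : ∀ i, (#(F i)).IsRegular := fun i ↦ by
    rw [hFc]
    exact Cardinal.isRegular_succ ((hI ▸ hω.le).trans (le_max_left _ _))
  have hK : ∀ i, (K i).Nodup := fun i ↦ by
    have : Nonempty (F i) := Cardinal.mk_ne_zero_iff.1 (hFreg i).ne_zero
    obtain ⟨x, hx⟩ := this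
    exact (hf x).sublist ((hF i).sublist x hx)
  obtain ⟨S, L, hS, hL⟩ := exists_isListSunflower hK
    (by rw [hI]; exact Cardinal.isRegular_cof (Cardinal.isSuccLimit_ord hωδ.le)) (hI ▸ hω)
  -- Only lists that meet other kernels inside their own kernel are admitted.
  let X : Type u := {x : I × ι // x.1 ∈ S ∧ x.2 ∈ F x.1 ∧
    ∀ j, ∀ v ∈ K j, v ∈ f x.2 → v ∈ K x.1}
  obtain ⟨T, hT, hdisj⟩ := exists_pairwiseDisjoint_of_forall_exists_disjoint hωδ
    (fun x : X ↦ petal f (K x.1.1) x.1.2) (fun _ ↦ finite_petal _ _ _)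
    (fun _ ↦ nonempty_petal _ _ _) fun C hC ↦ by
      obtain ⟨i, hiS, hi⟩ := hscale S hS _ hC
      have hIF : #I < #(F i) := by
        rw [hFc]; exact Order.lt_succ_of_le (le_max_left _ _)
      have hCF : #C < #(F i) := by
        rw [hFc]; exact Order.lt_succ_of_le (hi.le.trans (le_max_right _ _))
      obtain ⟨x, hx, hd⟩ := exists_disjoint_petal (f := f) (L := K i)
        (C := C ∪ ⋃ j, Sum.inr '' {v | v ∈ K j}) (hFreg i)
        (fun v hv ↦ (hF i).mk_lt
          (Cardinal.one_lt_aleph0.trans_le (hFreg i).aleph0_le) hv)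
        ((Cardinal.mk_union_le _ _).trans_lt (Cardinal.add_lt_of_lt (hFreg i).aleph0_le hCF
          ((Cardinal.card_iUnion_lt_iff_forall_of_isRegular (hFreg i) hIF).2 fun j ↦
            (Cardinal.lt_aleph0_iff_set_finite.2 ((K j).finite_toSet.image _)).trans_le
              (hFreg i).aleph0_le)))
      rw [Set.disjoint_union_right] at hd
      refine ⟨⟨(i, x), hiS, hx, fun j v hv hvx ↦ ?_⟩, hd.1⟩
      by_contra hvi
      exact Set.disjoint_left.1 hd.2 (Or.inr ⟨v, ⟨hvx, hvi⟩, rfl⟩)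
        (Set.mem_iUnion.2 ⟨j, v, hv, rfl⟩)
  have hinj : Set.InjOn (fun x : X ↦ x.1.2) T := fun x hx y hy hxy ↦ by
    by_contra hne
    exact ne_of_disjoint_petal (hdisj hx hy hne) hxy
  refine ⟨(fun x : X ↦ x.1.2) '' T, le_antisymm (Cardinal.mk_set_le _) ?_, ?_⟩
  · rwa [Cardinal.mk_image_eq_of_injOn _ _ hinj]
  rintro _ ⟨x, hx, rfl⟩ _ ⟨y, hy, rfl⟩ hxy
  obtain ⟨⟨i, p⟩, hiS, hp, hpK⟩ := x
  obtain ⟨⟨j, q⟩, hjS, hq, hqK⟩ := y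
  have hd := hdisj hx hy fun h ↦ hxy (congrArg (fun x : X ↦ x.1.2) h)
  dsimp only at *
  by_cases hij : i = j
  · subst hij
    exact (hF i).commonKernel hp hq hxy
  · refine ⟨L, (hL.sublist i hiS).trans ((hF i).sublist p hp),
      (hL.sublist j hjS).trans ((hF j).sublist q hq), fun v hvp hvq ↦ ?_⟩
    -- Disjoint petals put `v` in one kernel, and admissibility then puts it in the other.
    have hv : v ∈ K i ∧ v ∈ K j := by
      rcases mem_or_mem_of_disjoint_petal hd hvp hvq with hv | hv
      · exact ⟨hv, hqK i v hv hvq⟩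
      · exact ⟨hpK j v hv hvp, hv⟩
    exact hL.mem_kernel i hiS j hjS hij v hv.1 hv.2

theorem exists_commonKernel {f : ι → List V} (hf : ∀ i, (f i).Nodup)
    (hω : ℵ₀ < (#ι).ord.cof) :
    ∃ S : Set ι, #S = #ι ∧ S.Pairwise fun i j ↦ CommonKernel (f i) (f j) := by
  have hωι : ℵ₀ < #ι := hω.trans_le (Ordinal.cof_ord_le _)
  rcases Cardinal.isRegular_or_isSingular hωι.le with h | h
  · obtain ⟨S, L, hS, hL⟩ := exists_isListSunflower hf h hωι
    exact ⟨S, hS, fun i hi j hj hij ↦ hL.commonKernel hi hj hij⟩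
  · exact exists_commonKernel_of_isSingular hf h hω

end ListSunflower

theorem diracQuestion_of_aleph0_lt_cof {δ : Cardinal.{u}} (h : ℵ₀ < δ.ord.cof) :
    DiracQuestion δ := by
  rintro V E G - a - b - - ⟨ι, P, rfl, hP, hdisj⟩
  obtain ⟨S, hS, hpair⟩ := exists_commonKernel (f := fun i ↦ (P i).support) hP h
  refine ⟨S, fun i ↦ P i, hS, fun i ↦ hP i, fun i j hij ↦ hdisj i j (Subtype.coe_ne_coe.2 hij),
    fun i j hij x y hx hx' hy hy' ↦ ?_⟩
  exact (hpair i.2 j.2 (Subtype.coe_ne_coe.2 hij)).pair_sublist_iff (hP i) (hP j) hx hx' hy hy'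

/-! ### The zigzag graph and the negative answer. -/

section Zigzag

/-- The rational number `i / 3 ^ n`, as an element of a type in an arbitrary universe. -/
def ternary (n i : ℕ) : ULift.{u} ℚ := ⟨i / 3 ^ n⟩

theorem ternary_le_iff {n i j : ℕ} :
    (ternary.{u} n i).down ≤ (ternary.{u} n j).down ↔ i ≤ j := by
  simp only [ternary]
  rw [div_le_div_iff_of_pos_right (by positivity), Nat.cast_le]

theorem ternary_lt_iff {n i j : ℕ} :
    (ternary.{u} n i).down < (ternary.{u} n j).down ↔ i < j := by
  rw [← not_le, ternary_le_iff, not_le]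

theorem ternary_eq_iff {n i m j : ℕ} :
    ternary.{u} n i = ternary m j ↔ i * 3 ^ m = j * 3 ^ n := by
  rw [ULift.ext_iff]
  simp only [ternary]
  rw [div_eq_div_iff (by positivity) (by positivity)]
  exact_mod_cast Iff.rfl

theorem ternary_add (n d i : ℕ) : ternary.{u} n i = ternary (n + d) (i * 3 ^ d) := by
  rw [ternary_eq_iff]; ring

theorem ternary_succ (n i : ℕ) : ternary.{u} n i = ternary (n + 1) (3 * i) := by
  rw [ternary_add n 1, pow_one, mul_comm]

/-- The edges of the zigzag graph: an edge of level `n` lies in one of the `3 ^ n` intervals of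
length `3 ^ (-n)`, is one of the three edges there, and is one of `κ n` parallel copies. -/
abbrev ZigzagEdge (κ : ℕ → Cardinal.{u}) : Type u :=
  Σ n : ℕ, (Fin (3 ^ n) × Fin 3) × (κ n).out

namespace ZigzagEdge

variable {κ : ℕ → Cardinal.{u}}

/-- The first end of an edge. -/
def tail (e : ZigzagEdge κ) : ULift.{u} ℚ :=
  ternary (e.1 + 1) (3 * e.2.1.1 + ![0, 2, 1] e.2.1.2)

/-- The second end of an edge. -/
def head (e : ZigzagEdge κ) : ULift.{u} ℚ :=
  ternary (e.1 + 1) (3 * e.2.1.1 + ![2, 1, 3] e.2.1.2)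

theorem exists_ends (e : ZigzagEdge κ) : ∃ k l : ℕ, k ≤ 3 ∧ l ≤ 3 ∧ k ≠ l ∧
    e.tail = ternary (e.1 + 1) (3 * e.2.1.1 + k) ∧
    e.head = ternary (e.1 + 1) (3 * e.2.1.1 + l) := by
  refine ⟨_, _, ?_, ?_, ?_, rfl, rfl⟩ <;> generalize e.2.1.2 = s <;> fin_cases s <;> simp

theorem tail_ne_head (e : ZigzagEdge κ) : e.tail ≠ e.head := by
  obtain ⟨k, l, -, -, hne, ht, hh⟩ := e.exists_ends
  rw [ht, hh, Ne, ternary_eq_iff]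
  simpa using hne

end ZigzagEdge

/-- The graph on the rationals `i / 3 ^ n` in `[0, 1]` in which, for each interval
`[i / 3 ^ n, (i + 1) / 3 ^ n]`, the left end, the second third point, the first third point and the
right end are successively joined by `κ n` parallel edges. -/
def zigzagGraph (κ : ℕ → Cardinal.{u}) : Graph (ULift.{u} ℚ) (ZigzagEdge κ) where
  vertexSet := {x | ∃ m i, i ≤ 3 ^ m ∧ x = ternary m i}
  IsLink e x y := (x = e.tail ∧ y = e.head) ∨ (x = e.head ∧ y = e.tail)
  isLink_symm e _ := ⟨fun x y h ↦ by tauto⟩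
  eq_or_eq_of_isLink_of_isLink := by
    intro e x y v w h h'
    grind
  left_mem_of_isLink := by
    intro e x y h
    obtain ⟨k, l, hk, hl, -, ht, hh⟩ := e.exists_ends
    have := e.2.1.1.2
    have hp : 3 ^ (e.1 + 1) = 3 * 3 ^ e.1 := by ring
    rcases h with ⟨rfl, -⟩ | ⟨rfl, -⟩
    · exact ⟨_, _, by omega, ht⟩
    · exact ⟨_, _, by omega, hh⟩

variable {κ : ℕ → Cardinal.{u}}

theorem zigzagGraph_loopless : (zigzagGraph κ).Loopless := by
  refine ⟨fun e x h ↦ ?_⟩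
  rcases h with ⟨h, h'⟩ | ⟨h, h'⟩
  · exact e.tail_ne_head (h.symm.trans h')
  · exact e.tail_ne_head (h'.symm.trans h)

theorem zero_mem_zigzagGraph : ternary 0 0 ∈ V(zigzagGraph κ) := ⟨0, 0, by simp, rfl⟩

theorem one_mem_zigzagGraph : ternary 0 1 ∈ V(zigzagGraph κ) := ⟨0, 1, by simp, rfl⟩

theorem Graph.Walk.start_mem_support {V E : Type*} {G : Graph V E} {a b : V} (w : G.Walk a b) :
    a ∈ w.support := by
  cases w <;> simp [Graph.Walk.support]

theorem Graph.Walk.support_subset {V E : Type*} {G : Graph V E} {a b : V} (w : G.Walk a b)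
    {x : V} (hx : x ∈ w.support) : x ∈ V(G) := by
  induction w with
  | nil ha => simp_all [Graph.Walk.support]
  | cons e h w ih =>
    rcases List.mem_cons.1 hx with rfl | hx
    · exact h.left_mem
    · exact ih hx

/-- Zigzags through the `k` remaining intervals are concatenated. The lower bound on the vertices
keeps a newly prepended zigzag disjoint from the rest. -/
theorem exists_zigzag_path (n : ℕ) (t : (κ n).out) (k : ℕ) : ∀ i, i + k = 3 ^ n →
    ∃ w : (zigzagGraph κ).Walk (ternary n i) (ternary 0 1), w.IsPath ∧
      (∀ x ∈ w.support, (ternary.{u} n i).down ≤ x.down) ∧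
      ∀ e ∈ w.edges, ∃ p, e = ⟨n, p, t⟩ := by
  induction k with
  | zero =>
    intro i hi
    have h : ternary.{u} n i = ternary 0 1 := by rw [ternary_eq_iff]; simpa using hi
    rw [h]
    exact ⟨.nil one_mem_zigzagGraph, by simp [Graph.Walk.IsPath, Graph.Walk.support],
      by simp [Graph.Walk.support], by simp [Graph.Walk.edges]⟩
  | succ k ih =>
    intro i hi
    obtain ⟨w, hw, hle, he⟩ := ih (i + 1) (by omega)
    let e (s : Fin 3) : ZigzagEdge κ := ⟨n, (⟨i, by omega⟩, s), t⟩
    have h0 : (zigzagGraph κ).IsLink (e 0) (ternary n i) (ternary (n + 1) (3 * i + 2)) :=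
      Or.inl ⟨ternary_succ n i, rfl⟩
    have h1 : (zigzagGraph κ).IsLink (e 1) (ternary (n + 1) (3 * i + 2))
      (ternary (n + 1) (3 * i + 1)) := Or.inl ⟨rfl, rfl⟩
    have h2 : (zigzagGraph κ).IsLink (e 2) (ternary (n + 1) (3 * i + 1)) (ternary n (i + 1)) :=
      Or.inl ⟨rfl, ternary_succ n (i + 1)⟩
    replace hle : ∀ x ∈ w.support, (ternary.{u} (n + 1) (3 * (i + 1))).down ≤ x.down :=
      fun x hx ↦ by rw [← ternary_succ]; exact hle x hx
    have hnot : ∀ j < 3 * (i + 1), ternary (n + 1) j ∉ w.support := fun j hj hmem ↦ by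
      have := ternary_le_iff.1 (hle _ hmem)
      omega
    refine ⟨.cons _ h0 (.cons _ h1 (.cons _ h2 w)), ?_, ?_, ?_⟩
    · simp only [Graph.Walk.IsPath, Graph.Walk.support, List.nodup_cons, List.mem_cons, not_or]
      rw [ternary_succ n i]
      simp only [ternary_eq_iff]
      refine ⟨⟨?_, ?_, hnot _ (by omega)⟩, ⟨?_, hnot _ (by omega)⟩, hnot _ (by omega), hw⟩ <;>
        simp
    · simp only [Graph.Walk.support, List.mem_cons]
      rw [ternary_succ n i]
      rintro x (rfl | rfl | rfl | hx)
      · exact le_rfl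
      · exact ternary_le_iff.2 (by omega)
      · exact ternary_le_iff.2 (by omega)
      · exact (ternary_le_iff.2 (by omega)).trans (hle x hx)
    · simp only [Graph.Walk.edges, List.mem_cons]
      rintro x (rfl | rfl | rfl | hx)
      exacts [⟨_, rfl⟩, ⟨_, rfl⟩, ⟨_, rfl⟩, he x hx]

theorem zigzagGraph_edgeDisjointlyJoined :
    (zigzagGraph κ).EdgeDisjointlyJoined (Cardinal.sum κ) (ternary 0 0) (ternary 0 1) := by
  have h0 : ∀ n, ternary.{u} n 0 = ternary 0 0 := fun n ↦ by rw [ternary_eq_iff]; simp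
  have hpath : ∀ p : Σ n, (κ n).out, ∃ w : (zigzagGraph κ).Walk (ternary 0 0) (ternary 0 1),
      w.IsPath ∧ ∀ e ∈ w.edges, ∃ q, e = ⟨p.1, q, p.2⟩ := fun p ↦ by
    obtain ⟨w, hw, -, he⟩ := exists_zigzag_path p.1 p.2 (3 ^ p.1) 0 (by omega)
    rw [← h0 p.1]
    exact ⟨w, hw, he⟩
  choose P hP hPe using hpath
  refine ⟨Σ n, (κ n).out, P, by simp, hP, fun p q hpq e hp hq ↦ hpq ?_⟩
  obtain ⟨a, rfl⟩ := hPe p e hp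
  obtain ⟨b, hb⟩ := hPe q _ hq
  obtain ⟨n, s⟩ := p
  obtain ⟨m, t⟩ := q
  simp only [Sigma.mk.injEq] at hb
  obtain ⟨rfl, hb⟩ := hb
  simp only [heq_eq_eq, Prod.mk.injEq] at hb
  rw [hb.2]

/-- Edges of level at least `m` do not jump over multiples of `3 ^ (-m)`. -/
theorem zigzagGraph_isLink_le {m j : ℕ} {e : ZigzagEdge κ} (he : m ≤ e.1) {x y : ULift.{u} ℚ}
    (h : (zigzagGraph κ).IsLink e x y) (hx : x.down < (ternary.{u} m j).down) :
    y.down ≤ (ternary.{u} m j).down := by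
  obtain ⟨d, hd⟩ := Nat.exists_eq_add_of_le he
  obtain ⟨k, l, hk, hl, -, ht, hh⟩ := e.exists_ends
  rw [ternary_add m d, ← hd, ternary_succ] at hx ⊢
  rcases h with ⟨rfl, rfl⟩ | ⟨rfl, rfl⟩ <;> rw [ht, hh] at * <;>
    rw [ternary_lt_iff] at hx <;> rw [ternary_le_iff] <;> omega

/-- A discrete intermediate value theorem, as no step jumps over `j / 3 ^ m`. -/
theorem ternary_mem_support {m j : ℕ} {a b : ULift.{u} ℚ} (w : (zigzagGraph κ).Walk a b)
    (hw : ∀ e ∈ w.edges, m ≤ e.1) (ha : a.down ≤ (ternary.{u} m j).down)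
    (hb : (ternary.{u} m j).down ≤ b.down) : ternary m j ∈ w.support := by
  induction w with
  | nil _ => simpa [Graph.Walk.support] using ULift.ext _ _ (hb.antisymm ha)
  | cons e h w ih =>
    simp only [Graph.Walk.edges, List.forall_mem_cons] at hw
    rcases ha.eq_or_lt with ha | ha
    · exact List.mem_cons.2 (Or.inl (ULift.ext _ _ ha.symm))
    · exact List.mem_cons_of_mem _ (ih hw.2 (zigzagGraph_isLink_le hw.1 h ha) hb)

theorem ternary_pair_sublist_support {m i j : ℕ} (hij : i < j) {a b : ULift.{u} ℚ}
    (w : (zigzagGraph κ).Walk a b) (hw : ∀ e ∈ w.edges, m ≤ e.1)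
    (ha : a.down ≤ (ternary.{u} m i).down) (hb : (ternary.{u} m j).down ≤ b.down) :
    List.Sublist [ternary m i, ternary m j] w.support := by
  have hlt : (ternary.{u} m i).down < (ternary.{u} m j).down := ternary_lt_iff.2 hij
  induction w with
  | nil _ => exact absurd (hlt.trans_le (hb.trans ha)) (lt_irrefl _)
  | cons e h w ih =>
    simp only [Graph.Walk.edges, List.forall_mem_cons] at hw
    rcases ha.eq_or_lt with ha | ha
    · rw [Graph.Walk.support, ULift.ext _ _ ha]
      refine List.Sublist.cons_cons _ (List.singleton_sublist.2 (ternary_mem_support w hw.2 ?_ hb))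
      exact zigzagGraph_isLink_le hw.1 h (ha.trans_lt hlt)
    · exact (ih hw.2 (zigzagGraph_isLink_le hw.1 h ha) hb).cons _

theorem exists_forall_mem_support_eq_ternary {a b : ULift.{u} ℚ} (w : (zigzagGraph κ).Walk a b) :
    ∃ m, ∀ x ∈ w.support, ∃ j, j ≤ 3 ^ m ∧ x = ternary m j := by
  suffices ∀ l : List (ULift.{u} ℚ), (∀ x ∈ l, x ∈ V(zigzagGraph κ)) →
      ∃ m, ∀ x ∈ l, ∃ j, j ≤ 3 ^ m ∧ x = ternary m j from
    this _ fun x hx ↦ w.support_subset hx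
  intro l
  induction l with
  | nil => simp
  | cons y l ih =>
    intro h
    rw [List.forall_mem_cons] at h
    obtain ⟨m, hm⟩ := ih h.2
    obtain ⟨m', i, hi, rfl⟩ := h.1
    refine ⟨m + m', List.forall_mem_cons.2 ⟨⟨i * 3 ^ m, ?_, ?_⟩, fun x hx ↦ ?_⟩⟩
    · rw [pow_add, mul_comm]; gcongr
    · rw [add_comm, ← ternary_add]
    · obtain ⟨j, hj, rfl⟩ := hm x hx
      exact ⟨j * 3 ^ m', by rw [pow_add]; gcongr, ternary_add _ _ _⟩

/-- The number is a first third point of some interval of the ternary subdivision, or `1`. -/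
def IsFirstThird (x : ULift.{u} ℚ) : Prop := ∃ k j, x = ternary k (3 * j + 1)

theorem not_isFirstThird_zero : ¬ IsFirstThird.{u} (ternary 0 0) := by
  rintro ⟨k, j, h⟩
  rw [ternary_eq_iff] at h
  simp at h

/-- After cancelling powers of `3`, the two numerators differ modulo `3`. -/
theorem not_isFirstThird_secondThird (n i : ℕ) :
    ¬ IsFirstThird.{u} (ternary (n + 1) (3 * i + 2)) := by
  rintro ⟨k, j, h⟩
  rw [ternary_eq_iff] at h
  rcases lt_trichotomy k (n + 1) with hk | rfl | hk
  · obtain ⟨d, hd⟩ := Nat.exists_eq_add_of_lt hk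
    rw [hd, show k + d + 1 = (d + 1) + k by ring, pow_add, ← mul_assoc, pow_succ] at h
    have := Nat.eq_of_mul_eq_mul_right (by positivity) h
    rw [← mul_assoc] at this
    omega
  · have := Nat.eq_of_mul_eq_mul_right (by positivity) h
    omega
  · obtain ⟨d, rfl⟩ := Nat.exists_eq_add_of_lt hk
    rw [show n + 1 + d + 1 = (d + 1) + (n + 1) by ring, pow_add _ (d + 1), ← mul_assoc,
      pow_succ _ d] at h
    have := Nat.eq_of_mul_eq_mul_right (by positivity) h
    rw [← mul_assoc] at this
    omega

/-- In each interval, the only rising step that does not start at the first third point goes from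
the left end to the second third point. -/
theorem IsFirstThird.of_isLink {e : ZigzagEdge κ} {x y : ULift.{u} ℚ}
    (h : (zigzagGraph κ).IsLink e x y) (hxy : x.down < y.down) (hy : IsFirstThird y) :
    IsFirstThird x := by
  obtain ⟨n, ⟨i, s⟩, t⟩ := e
  have hlt : ∀ k l : ℕ, l ≤ k → x = ternary (n + 1) (3 * i + k) →
      y = ternary (n + 1) (3 * i + l) → False := by
    rintro k l hkl rfl rfl
    rw [ternary_lt_iff] at hxy
    omega
  rcases h with ⟨hx, hy'⟩ | ⟨hx, hy'⟩ <;> fin_cases s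
  · exact absurd hy ((show y = ternary (n + 1) (3 * i + 2) from hy') ▸
      not_isFirstThird_secondThird n i)
  · exact (hlt 2 1 (by omega) hx hy').elim
  · exact ⟨_, _, hx⟩
  · exact (hlt 2 0 (by omega) hx hy').elim
  · exact ⟨_, _, hx⟩
  · exact (hlt 3 1 (by omega) hx hy').elim

/-- An increasing walk in the zigzag graph that ends in a first third point, or in `1`, consists of
such points. -/
theorem IsFirstThird.of_walk {a b : ULift.{u} ℚ} (w : (zigzagGraph κ).Walk a b)
    (hw : w.support.Pairwise fun x y ↦ x.down < y.down) (hb : IsFirstThird b) :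
    IsFirstThird a := by
  induction w with
  | nil _ => exact hb
  | cons e h w ih =>
    rw [Graph.Walk.support, List.pairwise_cons] at hw
    exact (ih hw.2 hb).of_isLink h (hw.1 _ w.start_mem_support)

theorem mk_zigzagEdge_level_lt {δ : Cardinal.{u}} (hδ : ℵ₀ ≤ δ) (hκ : ∀ n, κ n < δ) (m : ℕ) :
    #{e : ZigzagEdge κ | e.1 < m} < δ := by
  induction m with
  | zero => simpa using Cardinal.aleph0_pos.trans_le hδ
  | succ m ih =>
    have hsub : {e : ZigzagEdge κ | e.1 < m + 1} ⊆
        {e | e.1 < m} ∪ Set.range fun p ↦ ⟨m, p⟩ := by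
      rintro ⟨n, p⟩ hn
      rcases Nat.lt_succ_iff_lt_or_eq.1 hn with hn | rfl
      · exact Or.inl hn
      · exact Or.inr ⟨p, rfl⟩
    refine (Cardinal.mk_le_mk_of_subset hsub).trans_lt ((Cardinal.mk_union_le _ _).trans_lt
      (Cardinal.add_lt_of_lt hδ ih (Cardinal.mk_range_le.trans_lt ?_)))
    rw [Cardinal.mk_prod, Cardinal.mk_out, Cardinal.lift_uzero]
    refine Cardinal.mul_lt_of_lt hδ (lt_of_lt_of_le ?_ hδ) (hκ m)
    exact Cardinal.lift_lt_aleph0.2 (Cardinal.lt_aleph0_of_finite _)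

theorem zigzagGraph_not_orderCompatiblyJoined {δ : Cardinal.{u}} (hδ : ℵ₀ ≤ δ)
    (hκ : ∀ n, κ n < δ) :
    ¬ (zigzagGraph κ).OrderCompatiblyJoined δ (ternary 0 0) (ternary 0 1) := by
  rintro ⟨ι, Q, rfl, hQ, hdisj, hcompat⟩
  have : Nonempty ι := Cardinal.mk_ne_zero_iff.1 (Cardinal.aleph0_pos.trans_le hδ).ne'
  obtain ⟨i⟩ := this
  obtain ⟨m, hm⟩ := exists_forall_mem_support_eq_ternary (Q i)
  -- Otherwise edge-disjointness would yield `δ` distinct edges below level `m`.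
  obtain ⟨j, hj⟩ : ∃ j, ∀ e ∈ (Q j).edges, m ≤ e.1 := by
    by_contra! h
    choose e he hem using h
    have hinj : Function.Injective fun k ↦ (⟨e k, hem k⟩ : {e : ZigzagEdge κ | e.1 < m}) := by
      intro k l hkl
      by_contra hne
      have hkl : e k = e l := congrArg Subtype.val hkl
      exact hdisj k l hne (he k) (hkl ▸ he l)
    exact (Cardinal.mk_le_of_injective hinj).not_gt (mk_zigzagEdge_level_lt hδ hκ m)
  have hbounds : ∀ k ≤ 3 ^ m, (ternary.{u} 0 0).down ≤ (ternary.{u} m k).down ∧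
      (ternary.{u} m k).down ≤ (ternary.{u} 0 1).down := fun k hk ↦ by
    rw [ternary_add 0 m 0, ternary_add 0 m 1, zero_add, ternary_le_iff, ternary_le_iff]
    omega
  have hsub : ∀ x ∈ (Q i).support, ∀ y ∈ (Q i).support, x.down < y.down →
      List.Sublist [x, y] (Q i).support := by
    intro x hx y hy hxy
    obtain ⟨k, hk, rfl⟩ := hm x hx
    obtain ⟨l, hl, rfl⟩ := hm y hy
    have hjsub := ternary_pair_sublist_support (ternary_lt_iff.1 hxy) (Q j) hj
      (hbounds k hk).1 (hbounds l hl).2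
    rcases eq_or_ne i j with rfl | hij
    · exact hjsub
    · exact (hcompat i j hij _ _ hx (hjsub.subset (by simp)) hy (hjsub.subset (by simp))).2 hjsub
  -- The end `1 = (3 * 0 + 1) / 3 ^ 0` counts as a first third point.
  refine not_isFirstThird_zero (IsFirstThird.of_walk (Q i) ?_ ⟨0, 0, rfl⟩)
  rw [List.pairwise_iff_forall_sublist]
  intro x y hxy
  have hne : x.down ≠ y.down := fun h ↦ by
    have := (hQ i).sublist hxy
    simp [ULift.ext _ _ h] at this
  refine hne.lt_or_gt.resolve_right fun hlt ↦ ?_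
  exact (hQ i).not_pair_sublist_swap hxy
    (hsub y (hxy.subset (by simp)) x (hxy.subset (by simp)) hlt)

end Zigzag

theorem not_diracQuestion_of_cof_le_aleph0 {δ : Cardinal.{u}} (hδ : ℵ₀ ≤ δ)
    (h : δ.ord.cof ≤ ℵ₀) : ¬ DiracQuestion δ := by
  obtain ⟨κ, hκ, hsum⟩ := Cardinal.exists_sum_eq_of_cof_le_aleph0 hδ h
  intro hD
  refine zigzagGraph_not_orderCompatiblyJoined hδ hκ (hD _ _ _ zigzagGraph_loopless _
    zero_mem_zigzagGraph _ one_mem_zigzagGraph ?_ ?_)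
  · rw [Ne, ternary_eq_iff]; simp
  · exact hsum ▸ zigzagGraph_edgeDisjointlyJoined

theorem corollary2 (δ : Cardinal.{u}) (hδ : ℵ₀ ≤ δ) :
    DiracQuestion δ ↔ ℵ₀ < δ.ord.cof := by
  refine ⟨fun h ↦ ?_, diracQuestion_of_aleph0_lt_cof⟩
  by_contra! hle
  exact not_diracQuestion_of_cof_le_aleph0 hδ hle h
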